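/- Let $0<q<1$. Write $(a;q)_n=\prod_{k=0}^{n-1}(1-aq^k)$, $(a;q)_\infty=\prod_{k=0}^{\infty}(1-aq^k)$, and $\genfrac{[}{]}{0pt}{}{n}{k}_q=\frac{(q;q)_n}{(q;q)_k(q;q)_{n-k}}$ for $0\le k\le n$. For integers $m,n\ge 0$ let $$h_{m,n}(z_1,z_2|q)=\sum_{j=0}^{\min(m,n)}\genfrac{[}{]}{0pt}{}{m}{j}_q\genfrac{[}{]}{0pt}{}{n}{j}_q\,q^{(m-j)(n-j)}(-1)^j(q;q)_j\,z_1^{m-j}z_2^{n-j}.$$ Then for all integers $m,n,s,t\ge 0$ the following integral over $\mathbb{R}^2$, with $z=x+iy$, converges absolutely and $$\int_{\mathbb{R}^2}h_{m,n}(z,\bar z|q)\,\overline{h_{s,t}(z,\bar z|q)}\,\frac{dx\,dy}{(-z\bar z;q)_\infty}=\frac{\pi\,\log(q^{-1})\,(q;q)_m(q;q)_n}{q^{(m-n)^2/2+(m+n)/2}}\,\delta_{m,s}\,\delta_{n,t}.$$ -/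

import Mathlib

/-- The finite `q`-shifted factorial `(a; q)_n = ∏_{k=0}^{n-1} (1 - a q^k)`. -/
def qPochhammer {R : Type*} [CommRing R] (a q : R) (n : ℕ) : R :=
  ∏ k ∈ Finset.range n, (1 - a * q ^ k)

/-- The infinite `q`-shifted factorial `(a; q)_∞ = ∏_{k=0}^∞ (1 - a q^k)`. -/
noncomputable def qPochhammerInf {R : Type*} [CommRing R] [TopologicalSpace R] (a q : R) : R :=
  ∏' k : ℕ, (1 - a * q ^ k)

/-- The Gaussian binomial coefficient `(q; q)_n / ((q; q)_k (q; q)_{n-k})`, used for `k ≤ n`. -/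
noncomputable def qBinomial {K : Type*} [Field K] (q : K) (n k : ℕ) : K :=
  qPochhammer q q n / (qPochhammer q q k * qPochhammer q q (n - k))

/-- The second `q`-analogue of the `2D`-Hermite polynomials, `h_{m,n}(z₁, z₂ | q)`. -/
noncomputable def qHermite2D {K : Type*} [Field K] (q : K) (m n : ℕ) (z₁ z₂ : K) : K :=
  ∑ j ∈ Finset.range (min m n + 1),
    qBinomial q m j * qBinomial q n j * q ^ ((m - j) * (n - j)) * (-1) ^ j *
      qPochhammer q q j * z₁ ^ (m - j) * z₂ ^ (n - j)

/-! Since `q` is real, expanding both polynomials reduces the integral to moments of `z ^ a * conj z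
^ b` against the weight `1 / W(|z|²)`, where `W(x) = (-x; q)_∞` satisfies `W(x) = (1 + x) W(q x)`.
Rotation invariance kills the moments with `a ≠ b`. For `a = b`, the functional equation and the
scaling `z ↦ √q z` give a recursion in `a`, and a Frullani integral supplies the value at `a = 0`
(`integral_weightedMonomial`).

What remains is a finite identity, `qHermite2DPairing_eq`. Pairing `h_{n+d,n}` with a monomial gives
a multiple of `(q^{-k}; q)_n`, by the `q`-binomial theorem (`sum_qHermite2DCoeff_mul_qMoment`). This
factor vanishes for `k < n`, which is the orthogonality; at `k = n` it gives the norm. -/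

open Finset Polynomial

/-! ### The finite `q`-binomial theorem and its vanishing consequences -/

section Algebra

variable {K : Type*} [Field K]

theorem qPochhammer_zero {R : Type*} [CommRing R] (a q : R) : qPochhammer a q 0 = 1 := by
  simp [qPochhammer]

theorem qPochhammer_succ {R : Type*} [CommRing R] (a q : R) (n : ℕ) :
    qPochhammer a q (n + 1) = qPochhammer a q n * (1 - a * q ^ n) := by
  simp [qPochhammer, prod_range_succ]

theorem qPochhammer_self_add {R : Type*} [CommRing R] (q : R) (a k : ℕ) :
    qPochhammer q q (a + k) =
      qPochhammer q q a * ∏ l ∈ range k, (1 - q ^ (a + 1 + l)) := by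
  simp only [qPochhammer, prod_range_add]
  congr 1
  exact prod_congr rfl fun l _ => by ring

/-- The summand of the finite `q`-binomial theorem, divided by `(q; q)_n`. -/
noncomputable def qBinomialTerm (q x : K) (p : ℕ × ℕ) : K :=
  (-1) ^ p.1 * q ^ (p.1.choose 2) * x ^ p.1 / (qPochhammer q q p.1 * qPochhammer q q p.2)

theorem qBinomialTerm_succ_left (q x : K) (hq : ∀ n, qPochhammer q q n ≠ 0) (i j : ℕ) :
    (1 - q ^ (i + 1)) * qBinomialTerm q x (i + 1, j) = -(x * q ^ i) * qBinomialTerm q x (i, j) := by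
  have h1 := hq (i + 1)
  rw [qPochhammer_succ] at h1
  have h2 := left_ne_zero_of_mul h1
  have h3 := right_ne_zero_of_mul h1
  have h4 := hq j
  have hc : (i + 1).choose 2 = i + i.choose 2 := by
    simp [Nat.choose_succ_succ' i 1]
  simp only [qBinomialTerm, qPochhammer_succ, hc]
  rw [show q ^ (i + 1) = q * q ^ i by ring]
  field_simp
  ring

theorem qBinomialTerm_succ_right (q x : K) (hq : ∀ n, qPochhammer q q n ≠ 0) (i j : ℕ) :
    (1 - q ^ (j + 1)) * qBinomialTerm q x (i, j + 1) = qBinomialTerm q x (i, j) := by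
  have h1 := hq (j + 1)
  rw [qPochhammer_succ] at h1
  have h2 := left_ne_zero_of_mul h1
  have h3 := right_ne_zero_of_mul h1
  have h4 := hq i
  simp only [qBinomialTerm, qPochhammer_succ]
  rw [show q ^ (j + 1) = q * q ^ j by ring]
  field_simp

/-- The finite `q`-binomial theorem. -/
theorem sum_antidiagonal_qBinomialTerm (q x : K) (hq : ∀ n, qPochhammer q q n ≠ 0) (n : ℕ) :
    ∑ p ∈ antidiagonal n, qBinomialTerm q x p = qPochhammer x q n / qPochhammer q q n := by
  induction n with
  | zero => simp [qBinomialTerm, qPochhammer]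
  | succ n ih =>
    have h1 := hq (n + 1)
    have h1' := h1
    rw [qPochhammer_succ] at h1'
    have h2 := left_ne_zero_of_mul h1'
    have h3 := right_ne_zero_of_mul h1'
    have key : (1 - q ^ (n + 1)) * ∑ p ∈ antidiagonal (n + 1), qBinomialTerm q x p =
        (1 - x * q ^ n) * ∑ p ∈ antidiagonal n, qBinomialTerm q x p := by
      -- For `i + j = n + 1`, `1 - q^(i+j) = (1 - q^j) + q^j (1 - q^i)`; each factor lowers one
      -- index of the term, reducing to the antidiagonal of `n`.
      have hsplit : (1 - q ^ (n + 1)) * ∑ p ∈ antidiagonal (n + 1), qBinomialTerm q x p =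
          ∑ p ∈ antidiagonal (n + 1), (1 - q ^ p.2) * qBinomialTerm q x p +
          ∑ p ∈ antidiagonal (n + 1), q ^ p.2 * ((1 - q ^ p.1) * qBinomialTerm q x p) := by
        rw [mul_sum, ← sum_add_distrib]
        refine sum_congr rfl fun p hp => ?_
        rw [← mem_antidiagonal.1 hp, pow_add]
        ring
      rw [hsplit, Nat.sum_antidiagonal_succ', Nat.sum_antidiagonal_succ]
      simp only [pow_zero, sub_self, zero_mul, mul_zero, zero_add,
        qBinomialTerm_succ_left q x hq, qBinomialTerm_succ_right q x hq]
      rw [mul_sum, ← sum_add_distrib]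
      refine sum_congr rfl fun p hp => ?_
      rw [← mem_antidiagonal.1 hp, pow_add]
      ring
    rw [ih] at key
    rw [eq_div_iff h1, qPochhammer_succ x, qPochhammer_succ q,
      show q * q ^ n = q ^ (n + 1) by ring]
    rw [show q * q ^ n = q ^ (n + 1) by ring] at h3
    calc _ = ((1 - q ^ (n + 1)) * ∑ p ∈ antidiagonal (n + 1), qBinomialTerm q x p) *
            qPochhammer q q n := by ring
      _ = _ := by rw [key]; field_simp

theorem qPochhammer_inv_pow_eq_zero {q : K} (hq0 : q ≠ 0) {r n : ℕ} (h : r < n) :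
    qPochhammer (q⁻¹ ^ r) q n = 0 :=
  prod_eq_zero (mem_range.2 h) (by simp [inv_pow, hq0])

theorem qPochhammer_inv_pow_self {q : K} (hq0 : q ≠ 0) (n : ℕ) :
    qPochhammer (q⁻¹ ^ n) q n = (-1) ^ n * qPochhammer q q n / q ^ ((n + 1).choose 2) := by
  have h : qPochhammer (q⁻¹ ^ n) q n = ∏ k ∈ range n, (1 - q⁻¹ ^ (k + 1)) := by
    rw [← prod_range_reflect, qPochhammer]
    refine prod_congr rfl fun k hk => ?_
    have hk := mem_range.1 hk
    have : q⁻¹ ^ n = q⁻¹ ^ (n - 1 - k + 1) * q⁻¹ ^ k := by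
      rw [← pow_add]; congr 1; omega
    rw [this, mul_assoc, ← mul_pow, inv_mul_cancel₀ hq0, one_pow, mul_one]
  rw [h]
  clear h
  induction n with
  | zero => simp [qPochhammer]
  | succ n ih =>
    have hc : (n + 1 + 1).choose 2 = n + 1 + (n + 1).choose 2 := by
      simp [Nat.choose_succ_succ' (n + 1) 1]
    rw [prod_range_succ, ih, qPochhammer_succ, hc, inv_pow]
    field_simp
    ring

/-- A monomial `(q^i)^l` shifts the argument `q^{-k}` to `q^{-(k-l)}`. For `1 ≤ l ≤ k ≤ n` the
resulting `(q^{-(k-l)}; q)_n` contains a zero factor, so only the constant term of `P` survives. -/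
theorem sum_qBinomialTerm_mul_eval {q : K} (hq0 : q ≠ 0) (hq : ∀ n, qPochhammer q q n ≠ 0)
    {k n : ℕ} (hkn : k ≤ n) (P : K[X]) (hP : P.natDegree ≤ k) :
    ∑ p ∈ antidiagonal n, qBinomialTerm q (q⁻¹ ^ k) p * P.eval (q ^ p.1) =
      P.coeff 0 * (qPochhammer (q⁻¹ ^ k) q n / qPochhammer q q n) := by
  have h : ∀ l ≤ k, ∑ p ∈ antidiagonal n, qBinomialTerm q (q⁻¹ ^ k) p * (P.coeff l * (q ^ p.1) ^ l)
      = P.coeff l * (qPochhammer (q⁻¹ ^ (k - l)) q n / qPochhammer q q n) := by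
    intro l hl
    rw [← sum_antidiagonal_qBinomialTerm q _ hq, mul_sum]
    refine sum_congr rfl fun p _ => ?_
    have : q⁻¹ ^ k = q⁻¹ ^ (k - l) * q⁻¹ ^ l := by rw [← pow_add]; congr 1; omega
    have h2 : (q⁻¹ ^ l) ^ p.1 * (q ^ p.1) ^ l = 1 := by
      rw [pow_right_comm, ← mul_pow, ← mul_pow, inv_mul_cancel₀ hq0, one_pow, one_pow]
    simp only [qBinomialTerm, this, mul_pow]
    linear_combination (P.coeff l * (-1) ^ p.1 * q ^ (p.1.choose 2) * (q⁻¹ ^ (k - l)) ^ p.1 /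
      (qPochhammer q q p.1 * qPochhammer q q p.2)) * h2
  simp only [eval_eq_sum_range' (Nat.lt_succ_of_le hP), mul_sum]
  rw [sum_comm, sum_eq_single_of_mem 0 (by simp)]
  · simpa using h 0 (Nat.zero_le _)
  · intro l hl hl0
    have hl := mem_range.1 hl
    rw [h l (by omega), qPochhammer_inv_pow_eq_zero hq0 (by omega)]
    simp

/-! ### Orthogonality with respect to the moment functional -/

/-- The coefficient of `z₁ ^ (m - j) * z₂ ^ (n - j)` in `h_{m,n}(z₁, z₂ | q)`. -/
noncomputable def qHermite2DCoeff (q : K) (m n j : ℕ) : K :=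
  qBinomial q m j * qBinomial q n j * q ^ ((m - j) * (n - j)) * (-1) ^ j * qPochhammer q q j

/-- The normalized moments `(q; q)_a q ^ (-a (a + 1) / 2)` of `1 / (-x; q)_∞`. -/
noncomputable def qMoment (q : K) (a : ℕ) : K :=
  qPochhammer q q a / q ^ ((a + 1).choose 2)

/-- The normalized moments of `1 / (-z * conj z; q)_∞` on the plane. -/
noncomputable def qMoment2D (q : K) (a b : ℕ) : K :=
  if a = b then qMoment q a else 0

theorem choose_two_identity (d i k : ℕ) :
    (d + i) * i + (d + k + 1).choose 2 + k * i = i.choose 2 + (d + i + k + 1).choose 2 := by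
  have : (((d + i) * i + (d + k + 1).choose 2 + k * i : ℕ) : ℚ) =
      ((i.choose 2 + (d + i + k + 1).choose 2 : ℕ) : ℚ) := by
    push_cast [Nat.cast_choose_two]
    ring
  exact_mod_cast this

/-- With `i = n - j`, the quotient `(q; q)_{d+i+k} / (q; q)_{d+i}` is a polynomial in `q^i` of
degree at most `k` with constant term 1. The remaining factors form the `q`-binomial summand at
`q^{-k}`, up to a constant, so the previous evaluation applies. -/
theorem sum_qHermite2DCoeff_mul_qMoment {q : K} (hq0 : q ≠ 0) (hq : ∀ n, qPochhammer q q n ≠ 0)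
    (d : ℕ) {n k : ℕ} (hkn : k ≤ n) :
    ∑ j ∈ range (n + 1), qHermite2DCoeff q (n + d) n j * qMoment q (n + d - j + k) =
      (-1) ^ n * qPochhammer q q (n + d) / q ^ ((d + k + 1).choose 2) *
        qPochhammer (q⁻¹ ^ k) q n := by
  -- Chosen so that `P(q^i) = (q; q)_{d+i+k} / (q; q)_{d+i}`.
  let P : K[X] := ∏ l ∈ range k, (1 - C (q ^ (d + 1 + l)) * X)
  have hP : P.natDegree ≤ k := by
    refine (natDegree_prod_le _ _).trans ?_
    refine (sum_le_card_nsmul _ _ 1 fun l _ => ?_).trans (by simp)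
    exact (natDegree_sub_le _ _).trans
      (max_le (by simp) ((natDegree_C_mul_le _ _).trans natDegree_X_le))
  have hP0 : P.coeff 0 = 1 := by
    rw [coeff_zero_eq_eval_zero, eval_prod]
    simp
  have key := sum_qBinomialTerm_mul_eval hq0 hq hkn P hP
  rw [hP0, one_mul] at key
  have hn := hq n
  have key' : qPochhammer (q⁻¹ ^ k) q n = qPochhammer q q n *
      ∑ p ∈ antidiagonal n, qBinomialTerm q (q⁻¹ ^ k) p * P.eval (q ^ p.1) := by
    rw [key]; field_simp
  rw [key', mul_sum, mul_sum,
    ← Nat.sum_antidiagonal_eq_sum_range_succ_mk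
      (fun p : ℕ × ℕ => qHermite2DCoeff q (n + d) n p.1 * qMoment q (n + d - p.1 + k)),
    ← Nat.sum_antidiagonal_swap]
  refine sum_congr rfl fun p hp => ?_
  obtain ⟨i, j⟩ := p
  obtain rfl : i + j = n := mem_antidiagonal.1 hp
  have e1 : i + j + d - j = d + i := by omega
  have e2 : i + j - j = i := by omega
  have hPe : qPochhammer q q (d + i + k) = qPochhammer q q (d + i) * P.eval (q ^ i) := by
    rw [qPochhammer_self_add, eval_prod]
    congr 1
    refine prod_congr rfl fun l _ => ?_
    simp only [eval_sub, eval_one, eval_mul, eval_C, eval_X, ← pow_add]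
    congr 2
    ring
  have hpow : q ^ ((d + i) * i) * q ^ ((d + k + 1).choose 2) * q ^ (k * i) =
      q ^ (i.choose 2) * q ^ ((d + i + k + 1).choose 2) := by
    rw [← pow_add, ← pow_add, ← pow_add, choose_two_identity]
  have hsign : ((-1 : K)) ^ (i + j) * (-1) ^ i = (-1) ^ j := by
    rw [pow_add, mul_right_comm, ← mul_pow]; simp
  have h1 := hq j
  have h2 := hq i
  have h3 := hq (d + i)
  simp only [Prod.swap, qHermite2DCoeff, qBinomial, qMoment, qBinomialTerm, e1, e2, hPe]
  rw [← hsign, inv_pow, inv_pow, ← pow_mul]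
  field_simp
  linear_combination qPochhammer q q (i + j + d) * P.eval (q ^ i) * hpow

/-- The moment functional applied to `h_{m,n}` times the conjugate of `h_{s,t}`. -/
noncomputable def qHermite2DPairing (q : K) (m n s t : ℕ) : K :=
  ∑ j ∈ range (min m n + 1), ∑ k ∈ range (min s t + 1),
    qHermite2DCoeff q m n j * qHermite2DCoeff q s t k *
      qMoment2D q (m - j + (t - k)) (n - j + (s - k))

theorem qMoment2D_comm (q : K) (a b : ℕ) : qMoment2D q a b = qMoment2D q b a := by
  unfold qMoment2D
  split_ifs with h h' h' <;> simp_all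

theorem qHermite2DCoeff_comm (q : K) (m n j : ℕ) :
    qHermite2DCoeff q m n j = qHermite2DCoeff q n m j := by
  simp only [qHermite2DCoeff, mul_comm (m - j)]
  ring

theorem qHermite2DPairing_comm (q : K) (m n s t : ℕ) :
    qHermite2DPairing q m n s t = qHermite2DPairing q s t m n := by
  unfold qHermite2DPairing
  rw [sum_comm]
  refine sum_congr rfl fun k _ => sum_congr rfl fun j _ => ?_
  rw [qMoment2D_comm, add_comm (n - j), add_comm (m - j)]
  ring

theorem qHermite2DPairing_swap (q : K) (m n s t : ℕ) :
    qHermite2DPairing q m n s t = qHermite2DPairing q n m t s := by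
  unfold qHermite2DPairing
  rw [min_comm m, min_comm s]
  refine sum_congr rfl fun k _ => sum_congr rfl fun j _ => ?_
  rw [qMoment2D_comm, qHermite2DCoeff_comm q m, qHermite2DCoeff_comm q s]

/-- The difference of the two moment indices does not depend on `j` and `k`, so every moment is
off-diagonal. -/
theorem qHermite2DPairing_eq_zero_of_ne (q : K) {m n s t : ℕ} (h : m + t ≠ n + s) :
    qHermite2DPairing q m n s t = 0 := by
  refine sum_eq_zero fun j hj => sum_eq_zero fun k hk => ?_
  have hj := mem_range.1 hj
  have hk := mem_range.1 hk
  rw [qMoment2D, if_neg (by omega), mul_zero]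

theorem qHermite2DPairing_add_left {q : K} (hq0 : q ≠ 0) (hq : ∀ n, qPochhammer q q n ≠ 0)
    (d : ℕ) {n t : ℕ} (h : t ≤ n) :
    qHermite2DPairing q (n + d) n (t + d) t =
      ∑ k ∈ range (t + 1), qHermite2DCoeff q (t + d) t k *
        ((-1) ^ n * qPochhammer q q (n + d) / q ^ ((d + (t - k) + 1).choose 2) *
          qPochhammer (q⁻¹ ^ (t - k)) q n) := by
  unfold qHermite2DPairing
  rw [sum_comm, min_eq_right (Nat.le_add_right t d), min_eq_right (Nat.le_add_right n d)]
  refine sum_congr rfl fun k hk => ?_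
  have hk := mem_range.1 hk
  rw [← sum_qHermite2DCoeff_mul_qMoment hq0 hq d (by omega), mul_sum]
  refine sum_congr rfl fun j hj => ?_
  have hj := mem_range.1 hj
  rw [qMoment2D, if_pos (by omega)]
  ring

theorem qHermite2DPairing_eq_zero_of_lt {q : K} (hq0 : q ≠ 0) (hq : ∀ n, qPochhammer q q n ≠ 0)
    (d : ℕ) {n t : ℕ} (h : t < n) : qHermite2DPairing q (n + d) n (t + d) t = 0 := by
  rw [qHermite2DPairing_add_left hq0 hq d h.le]
  refine sum_eq_zero fun k _ => ?_
  rw [qPochhammer_inv_pow_eq_zero hq0 (by omega)]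
  simp

theorem qHermite2DPairing_add_self {q : K} (hq0 : q ≠ 0) (hq : ∀ n, qPochhammer q q n ≠ 0)
    (d n : ℕ) : qHermite2DPairing q (n + d) n (n + d) n =
      qPochhammer q q (n + d) * qPochhammer q q n * q ^ ((n + d) * n) /
        (q ^ ((n + d + 1).choose 2) * q ^ ((n + 1).choose 2)) := by
  -- Only the leading term `k = 0` of the second polynomial survives: `(q^{-(n-k)}; q)_n = 0` for `k
  -- > 0`.
  rw [qHermite2DPairing_add_left hq0 hq d le_rfl, sum_eq_single_of_mem 0 (by simp)]
  · have h1 := hq (n + d)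
    have h2 := hq n
    simp only [qHermite2DCoeff, qBinomial, qPochhammer_zero, Nat.sub_zero,
      qPochhammer_inv_pow_self hq0, add_comm d n, pow_zero]
    have hs : ((-1 : K) ^ n) ^ 2 = 1 := by rw [← pow_mul, mul_comm, pow_mul]; simp
    field_simp
    linear_combination hs
  · intro k hk hk0
    have hk := mem_range.1 hk
    rw [qPochhammer_inv_pow_eq_zero hq0 (by omega)]
    simp

theorem qHermite2DPairing_eq {q : K} (hq0 : q ≠ 0) (hq : ∀ n, qPochhammer q q n ≠ 0)
    (m n s t : ℕ) : qHermite2DPairing q m n s t =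
      if m = s ∧ n = t then qPochhammer q q m * qPochhammer q q n * q ^ (m * n) /
        (q ^ ((m + 1).choose 2) * q ^ ((n + 1).choose 2)) else 0 := by
  -- Conjugation symmetry exchanges the two indices of both polynomials.
  wlog hmn : n ≤ m generalizing m n s t
  · rw [qHermite2DPairing_swap, this n m t s (by omega)]
    simp only [and_comm, mul_comm]
  obtain ⟨d, rfl⟩ := Nat.exists_eq_add_of_le hmn
  by_cases hne : n + d + t = n + s
  · obtain rfl : s = t + d := by omega
    rcases lt_trichotomy t n with h | rfl | h
    · rw [qHermite2DPairing_eq_zero_of_lt hq0 hq d h, if_neg (by omega)]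
    · rw [qHermite2DPairing_add_self hq0 hq, if_pos ⟨rfl, rfl⟩]
    · rw [qHermite2DPairing_comm, qHermite2DPairing_eq_zero_of_lt hq0 hq d h, if_neg (by omega)]
  · rw [qHermite2DPairing_eq_zero_of_ne q hne, if_neg (by omega)]

end Algebra

/-! ### Growth of the weight and absolute convergence -/

section Analysis

open MeasureTheory Filter Topology Set ComplexConjugate

variable {q : ℝ}

theorem tendsto_qPochhammer (hq0 : 0 < q) (hq1 : q < 1) (x : ℝ) :
    Tendsto (qPochhammer x q) atTop (𝓝 (qPochhammerInf x q)) := by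
  have hs : Summable fun k : ℕ => -(x * q ^ k) :=
    ((summable_geometric_of_lt_one hq0.le hq1).mul_left x).neg
  have h := (Real.multipliable_one_add_of_summable hs).hasProd.tendsto_prod_nat
  simp only [← sub_eq_add_neg] at h
  exact h

theorem qPochhammerInf_eq_mul (hq0 : 0 < q) (hq1 : q < 1) (x : ℝ) :
    qPochhammerInf x q = (1 - x) * qPochhammerInf (q * x) q := by
  refine tendsto_nhds_unique ((tendsto_add_atTop_iff_nat 1).2 (tendsto_qPochhammer hq0 hq1 x)) ?_
  refine ((tendsto_qPochhammer hq0 hq1 (q * x)).const_mul (1 - x)).congr fun n => ?_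
  simp only [qPochhammer, prod_range_succ', pow_zero, mul_one]
  rw [mul_comm]
  congr 1
  exact prod_congr rfl fun k _ => by ring

theorem qPochhammerInf_neg_eq_mul (hq0 : 0 < q) (hq1 : q < 1) (x : ℝ) :
    qPochhammerInf (-x) q = (1 + x) * qPochhammerInf (-(q * x)) q := by
  rw [qPochhammerInf_eq_mul hq0 hq1, sub_neg_eq_add, mul_neg]

theorem one_le_qPochhammerInf_neg (hq0 : 0 < q) (hq1 : q < 1) {x : ℝ} (hx : 0 ≤ x) :
    1 ≤ qPochhammerInf (-x) q := by
  refine ge_of_tendsto' (tendsto_qPochhammer hq0 hq1 (-x)) fun n => ?_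
  refine prod_induction _ (1 ≤ ·) (fun _ _ => one_le_mul_of_one_le_of_one_le) le_rfl fun k _ => ?_
  have : 0 ≤ x * q ^ k := by positivity
  linarith

/-- Together with the lower bound 1, this squeezes the weight to 1 at the origin, as the Frullani
integral requires. -/
theorem qPochhammerInf_neg_le_exp (hq0 : 0 < q) (hq1 : q < 1) {x : ℝ} (hx : 0 ≤ x) :
    qPochhammerInf (-x) q ≤ Real.exp (x * (1 - q)⁻¹) := by
  refine le_of_tendsto' (tendsto_qPochhammer hq0 hq1 (-x)) fun n => ?_
  calc qPochhammer (-x) q n ≤ ∏ k ∈ range n, Real.exp (x * q ^ k) := by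
        refine prod_le_prod (fun k _ => ?_) fun k _ => ?_
        · have : 0 ≤ x * q ^ k := by positivity
          linarith
        · have := Real.add_one_le_exp (x * q ^ k)
          linarith
    _ = Real.exp (x * ∑ k ∈ range n, q ^ k) := by rw [← Real.exp_sum, mul_sum]
    _ ≤ _ := by
        gcongr
        rw [← tsum_geometric_of_lt_one hq0.le hq1]
        exact (summable_geometric_of_lt_one hq0.le hq1).sum_le_tsum _ fun k _ => by positivity

theorem exists_mul_one_add_pow_le_qPochhammerInf_neg (hq0 : 0 < q) (hq1 : q < 1) (N : ℕ) :
    ∃ c > 0, ∀ x : ℝ, 0 ≤ x → c * (1 + x) ^ N ≤ qPochhammerInf (-x) q := by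
  induction N with
  | zero => exact ⟨1, one_pos, fun x hx => by simpa using one_le_qPochhammerInf_neg hq0 hq1 hx⟩
  | succ N ih =>
    obtain ⟨c, hc, h⟩ := ih
    -- The factor `q ^ N` pays for `1 + q x ≥ q (1 + x)` when the bound for `N` is applied at `q x`.
    refine ⟨c * q ^ N, by positivity, fun x hx => ?_⟩
    rw [qPochhammerInf_neg_eq_mul hq0 hq1]
    calc c * q ^ N * (1 + x) ^ (N + 1) = (1 + x) * (c * (q * (1 + x)) ^ N) := by
          rw [mul_pow]; ring
      _ ≤ (1 + x) * (c * (1 + q * x) ^ N) := by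
          gcongr
          linarith
      _ ≤ _ := by
          gcongr
          exact h _ (by positivity)

theorem measurable_qPochhammerInf (hq0 : 0 < q) (hq1 : q < 1) :
    Measurable fun x : ℝ => qPochhammerInf x q := by
  refine measurable_of_tendsto_metrizable (f := fun n x => qPochhammer x q n) (fun n => ?_)
    (tendsto_pi_nhds.2 fun x => tendsto_qPochhammer hq0 hq1 x)
  unfold qPochhammer
  fun_prop

/-- The monomial `z ^ a * conj z ^ b` times the weight `1 / (-z * conj z; q)_∞`. -/
noncomputable def weightedMonomial (q : ℝ) (a b : ℕ) (z : ℂ) : ℂ :=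
  z ^ a * conj z ^ b / ((qPochhammerInf (-‖z‖ ^ 2) q : ℝ) : ℂ)

theorem integrable_weightedMonomial (hq0 : 0 < q) (hq1 : q < 1) (a b : ℕ) :
    Integrable (weightedMonomial q a b) := by
  -- The power `a + b` absorbs the monomial, as `‖z‖ ≤ 1 + ‖z‖²`; the extra 2 leaves `(1 +
  -- ‖z‖²)^(-2)`, integrable in real dimension two.
  obtain ⟨c, hc, h⟩ := exists_mul_one_add_pow_le_qPochhammerInf_neg hq0 hq1 (a + b + 2)
  have hint : Integrable fun z : ℂ => c⁻¹ * (1 + ‖z‖ ^ 2) ^ (-(4 : ℝ) / 2) :=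
    (integrable_rpow_neg_one_add_norm_sq (by simp; norm_num)).const_mul _
  have hm := measurable_qPochhammerInf hq0 hq1
  refine hint.mono' ?_ (.of_forall fun z => ?_)
  · refine Measurable.aestronglyMeasurable ?_
    unfold weightedMonomial
    have : Measurable fun z : ℂ => qPochhammerInf (-‖z‖ ^ 2) q := hm.comp (by fun_prop)
    have h2 : Measurable fun z : ℂ => conj z := Complex.continuous_conj.measurable
    fun_prop
  · have hx : 0 ≤ ‖z‖ ^ 2 := by positivity
    have h1 := h _ hx
    have hW := one_le_qPochhammerInf_neg hq0 hq1 hx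
    have hz : ‖z‖ ≤ 1 + ‖z‖ ^ 2 := by nlinarith [sq_nonneg (‖z‖ - 1)]
    have hr : (1 + ‖z‖ ^ 2) ^ (-(4 : ℝ) / 2) = ((1 + ‖z‖ ^ 2) ^ 2)⁻¹ := by
      rw [show -(4 : ℝ) / 2 = -((2 : ℕ) : ℝ) by norm_num, Real.rpow_neg (by positivity),
        Real.rpow_natCast]
    rw [weightedMonomial, norm_div, norm_mul, norm_pow, norm_pow, RCLike.norm_conj,
      Complex.norm_real, Real.norm_eq_abs, abs_of_nonneg (zero_le_one.trans hW), ← pow_add, hr,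
      ← mul_inv, ← one_div, div_le_div_iff₀ (by linarith) (by positivity), one_mul]
    calc ‖z‖ ^ (a + b) * (c * (1 + ‖z‖ ^ 2) ^ 2)
        ≤ (1 + ‖z‖ ^ 2) ^ (a + b) * (c * (1 + ‖z‖ ^ 2) ^ 2) := by gcongr
      _ = c * (1 + ‖z‖ ^ 2) ^ (a + b + 2) := by ring
      _ ≤ _ := h1

/-! ### Moments of the weight on the plane -/

theorem integral_weightedMonomial_of_ne {a b : ℕ} (hab : a ≠ b) :
    ∫ z, weightedMonomial q a b z = 0 := by
  have hab' : (a : ℝ) - b ≠ 0 := sub_ne_zero.2 (by exact_mod_cast hab)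
  -- This angle makes rotation by `c` multiply the integrand by `exp(iπ) = -1`, while preserving the
  -- measure.
  let c : Circle := Circle.exp (Real.pi / (a - b))
  have hc : (c : ℂ) ^ a * conj (c : ℂ) ^ b = -1 := by
    rw [Circle.coe_exp, ← Complex.exp_conj, ← Complex.exp_nat_mul, ← Complex.exp_nat_mul,
      ← Complex.exp_add, ← Complex.exp_pi_mul_I]
    congr 1
    have : (a : ℂ) - b ≠ 0 := by exact_mod_cast hab'
    simp only [map_mul, Complex.conj_ofReal, Complex.conj_I]
    push_cast
    field_simp
    ring
  have hrot : ∀ z, weightedMonomial q a b (rotation c z) = -weightedMonomial q a b z := by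
    intro z
    have hnorm : ‖(c : ℂ) * z‖ = ‖z‖ := by rw [norm_mul, Circle.norm_coe, one_mul]
    simp only [weightedMonomial, rotation_apply, hnorm, map_mul, mul_pow]
    linear_combination (z ^ a * conj z ^ b / ((qPochhammerInf (-‖z‖ ^ 2) q : ℝ) : ℂ)) * hc
  have h := (rotation c).measurePreserving.integral_comp
    (rotation c).toHomeomorph.measurableEmbedding (weightedMonomial q a b)
  simp only [hrot, integral_neg] at h
  exact self_eq_neg.1 h.symm

/-- Substituting `√q z` and using `1 / W(q x) = (1 + x) / W(x)` gives `q⁻¹ I_n = q^n (I_n +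
I_{n+1})` for the diagonal moments `I_n`. -/
theorem integral_weightedMonomial_succ (hq0 : 0 < q) (hq1 : q < 1) (n : ℕ) :
    ∫ z, weightedMonomial q (n + 1) (n + 1) z =
      ((1 - q ^ (n + 1)) / q ^ (n + 1) : ℂ) * ∫ z, weightedMonomial q n n z := by
  have hscale : ∀ z, weightedMonomial q n n (√q • z) =
      (q : ℂ) ^ n * (weightedMonomial q n n z + weightedMonomial q (n + 1) (n + 1) z) := by
    intro z
    have hsq : (√q : ℂ) ^ 2 = q := by exact_mod_cast Real.sq_sqrt hq0.le
    have hz : z * conj z = (‖z‖ : ℂ) ^ 2 := Complex.mul_conj' z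
    have hn : -‖√q • z‖ ^ 2 = -(q * ‖z‖ ^ 2) := by
      rw [norm_smul, mul_pow, Real.norm_eq_abs, sq_abs, Real.sq_sqrt hq0.le]
    have hx : 0 ≤ q * ‖z‖ ^ 2 := by positivity
    have hW : qPochhammerInf (-(q * ‖z‖ ^ 2)) q ≠ 0 :=
      (zero_lt_one.trans_le (one_le_qPochhammerInf_neg hq0 hq1 hx)).ne'
    have h1 : (1 + ‖z‖ ^ 2 : ℝ) ≠ 0 := by positivity
    have h1' : (1 + (‖z‖ : ℂ) ^ 2) ≠ 0 := by exact_mod_cast h1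
    have hW' : ((qPochhammerInf (-(q * ‖z‖ ^ 2)) q : ℝ) : ℂ) ≠ 0 := by exact_mod_cast hW
    simp only [weightedMonomial, hn]
    rw [qPochhammerInf_neg_eq_mul hq0 hq1 (‖z‖ ^ 2)]
    simp only [← mul_pow, Complex.real_smul, map_mul, Complex.conj_ofReal, hz]
    rw [show (√q : ℂ) * z * (√q * conj z) = √q ^ 2 * (z * conj z) by ring, hsq, hz]
    push_cast
    field_simp
    ring
  have h := Measure.integral_comp_smul volume (weightedMonomial q n n) √q
  simp only [hscale] at h
  rw [integral_const_mul, integral_add (integrable_weightedMonomial hq0 hq1 n n)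
    (integrable_weightedMonomial hq0 hq1 _ _), Complex.finrank_real_complex, Real.sq_sqrt hq0.le,
    abs_of_pos (inv_pos.2 hq0), Complex.real_smul] at h
  have hqc : (q : ℂ) ≠ 0 := by exact_mod_cast hq0.ne'
  push_cast at h
  field_simp at h ⊢
  linear_combination h

theorem tendsto_inv_qPochhammerInf_neg_sq_nhdsGT (hq0 : 0 < q) (hq1 : q < 1) :
    Tendsto (fun r : ℝ => (qPochhammerInf (-r ^ 2) q)⁻¹) (𝓝[>] 0) (𝓝 1) := by
  have hexp : Tendsto (fun r : ℝ => Real.exp (r ^ 2 * (1 - q)⁻¹)) (𝓝[>] 0) (𝓝 1) := by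
    have : Continuous fun r : ℝ => Real.exp (r ^ 2 * (1 - q)⁻¹) := by fun_prop
    simpa using (this.tendsto 0).mono_left nhdsWithin_le_nhds
  have h := tendsto_of_tendsto_of_tendsto_of_le_of_le tendsto_const_nhds hexp
    (fun r => one_le_qPochhammerInf_neg hq0 hq1 (sq_nonneg r))
    (fun r => qPochhammerInf_neg_le_exp hq0 hq1 (sq_nonneg r))
  simpa using h.inv₀ one_ne_zero

theorem tendsto_inv_qPochhammerInf_neg_sq_atTop (hq0 : 0 < q) (hq1 : q < 1) :
    Tendsto (fun r : ℝ => (qPochhammerInf (-r ^ 2) q)⁻¹) atTop (𝓝 0) := by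
  refine Tendsto.inv_tendsto_atTop (tendsto_atTop_mono (fun r => ?_) tendsto_id)
  have hx := sq_nonneg r
  have h1 := one_le_qPochhammerInf_neg hq0 hq1 (x := q * r ^ 2) (by positivity)
  rw [qPochhammerInf_neg_eq_mul hq0 hq1]
  simp only [id]
  nlinarith [sq_nonneg (r - 1)]

theorem integral_weightedMonomial_zero (hq0 : 0 < q) (hq1 : q < 1) :
    ∫ z, weightedMonomial q 0 0 z = ((Real.pi * Real.log q⁻¹ : ℝ) : ℂ) := by
  let f : ℝ → ℝ := fun r => (qPochhammerInf (-r ^ 2) q)⁻¹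
  have hW : ∀ r : ℝ, 1 ≤ qPochhammerInf (-r ^ 2) q := fun r =>
    one_le_qPochhammerInf_neg hq0 hq1 (sq_nonneg r)
  have hg : ∀ z, weightedMonomial q 0 0 z = ((f ‖z‖ : ℝ) : ℂ) := fun z => by
    simp [weightedMonomial, f]
  have hint : Integrable fun z : ℂ => f ‖z‖ := by
    have := (integrable_weightedMonomial hq0 hq1 0 0).re
    simpa only [hg, RCLike.re_eq_complex_re, Complex.ofReal_re] using this
  rw [integrable_fun_norm_addHaar] at hint
  simp only [hg]
  rw [integral_complex_ofReal, integral_fun_norm_addHaar volume f]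
  simp only [Complex.finrank_real_complex, Nat.add_one_sub_one, pow_one] at hint ⊢
  -- Since `f(√q r) = (1 + r²) f(r)`, the radial integrand `r f(r)` is a Frullani integrand with
  -- ratio `√q`. Its integral is `log(1/√q)`, and the angular factor `2π` yields `π log(1/q)`.
  have hfun : ∀ r ∈ Ioi (0 : ℝ), r • f r = r⁻¹ • (f (√q * r) - f (1 * r)) := by
    intro r hr
    have hr0 : r ≠ 0 := (mem_Ioi.1 hr).ne'
    have h1 : qPochhammerInf (-(q * r ^ 2)) q ≠ 0 :=
      (zero_lt_one.trans_le (one_le_qPochhammerInf_neg hq0 hq1 (by positivity))).ne'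
    have h2 : (1 + r ^ 2) ≠ 0 := by positivity
    simp only [f, mul_pow, Real.sq_sqrt hq0.le, one_mul, smul_eq_mul]
    rw [qPochhammerInf_neg_eq_mul hq0 hq1 (r ^ 2)]
    field_simp
    ring
  have hloc : LocallyIntegrableOn f (Ioi 0) := by
    refine LocallyIntegrable.locallyIntegrableOn ?_ _
    refine (locallyIntegrable_const (1 : ℝ)).mono ?_ (.of_forall fun r => ?_)
    · exact ((measurable_qPochhammerInf hq0 hq1).comp
        (by fun_prop : Measurable fun r : ℝ => -r ^ 2)).inv.aestronglyMeasurable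
    · rw [norm_one, Real.norm_eq_abs, abs_of_nonneg (inv_nonneg.2 (zero_le_one.trans (hW r)))]
      exact inv_le_one_of_one_le₀ (hW r)
  have hfr := Frullani.integral_Ioi_eq hloc (Real.sqrt_pos.2 hq0) one_pos
    (tendsto_inv_qPochhammerInf_neg_sq_nhdsGT hq0 hq1)
    (tendsto_inv_qPochhammerInf_neg_sq_atTop hq0 hq1)
    (hint.congr_fun hfun measurableSet_Ioi)
  rw [setIntegral_congr_fun measurableSet_Ioi hfun, hfr, Measure.real, Complex.volume_ball]
  simp only [one_div, Real.log_inv, Real.log_sqrt hq0.le]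
  simp
  ring

theorem integral_weightedMonomial (hq0 : 0 < q) (hq1 : q < 1) (a b : ℕ) :
    ∫ z, weightedMonomial q a b z =
      ((Real.pi * Real.log q⁻¹ : ℝ) : ℂ) * qMoment2D (q : ℂ) a b := by
  unfold qMoment2D
  split_ifs with hab
  · subst hab
    induction a with
    | zero => rw [integral_weightedMonomial_zero hq0 hq1]; simp [qMoment, qPochhammer]
    | succ a ih =>
      have hc : (a + 1 + 1).choose 2 = a + 1 + (a + 1).choose 2 := by
        simp [Nat.choose_succ_succ' (a + 1) 1]
      have hqc : (q : ℂ) ≠ 0 := by exact_mod_cast hq0.ne'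
      rw [integral_weightedMonomial_succ hq0 hq1, ih, qMoment, qMoment, hc, qPochhammer_succ]
      field_simp
      ring
  · rw [integral_weightedMonomial_of_ne hab, mul_zero]

/-! ### Reduction of the integral to the moment pairing -/

theorem qPochhammer_self_ne_zero (hq0 : 0 < q) (hq1 : q < 1) (n : ℕ) :
    qPochhammer (q : ℂ) q n ≠ 0 := by
  refine prod_ne_zero_iff.2 fun k _ => ?_
  have : (1 - q * q ^ k : ℝ) ≠ 0 := by
    rw [← pow_succ', sub_ne_zero]
    exact (pow_lt_one₀ hq0.le hq1 k.succ_ne_zero).ne'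
  exact_mod_cast this

theorem qHermite2D_mul_conj_div (m n s t : ℕ) (z : ℂ) :
    qHermite2D (q : ℂ) m n z (conj z) * conj (qHermite2D (q : ℂ) s t z (conj z)) /
        ((qPochhammerInf (-‖z‖ ^ 2) q : ℝ) : ℂ) =
      ∑ j ∈ range (min m n + 1), ∑ k ∈ range (min s t + 1),
        qHermite2DCoeff (q : ℂ) m n j * qHermite2DCoeff (q : ℂ) s t k *
          weightedMonomial q (m - j + (t - k)) (n - j + (s - k)) z := by
  have hconj : ∀ k, conj (qHermite2DCoeff (q : ℂ) s t k) = qHermite2DCoeff (q : ℂ) s t k := by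
    intro k
    simp [qHermite2DCoeff, qBinomial, qPochhammer]
  have h1 : ∀ m n z₁ z₂, qHermite2D (q : ℂ) m n z₁ z₂ = ∑ j ∈ range (min m n + 1),
      qHermite2DCoeff (q : ℂ) m n j * (z₁ ^ (m - j) * z₂ ^ (n - j)) := by
    intro m n z₁ z₂
    exact sum_congr rfl fun j _ => by rw [qHermite2DCoeff]; ring
  rw [h1, h1, map_sum, sum_mul_sum, sum_div]
  refine sum_congr rfl fun j _ => ?_
  rw [sum_div]
  refine sum_congr rfl fun k _ => ?_
  simp only [map_mul, map_pow, hconj, Complex.conj_conj, weightedMonomial, pow_add]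
  ring

end Analysis

theorem mainTheorem5 (q : ℝ) (hq0 : 0 < q) (hq1 : q < 1) (m n s t : ℕ) :
    MeasureTheory.Integrable (fun z : ℂ =>
      qHermite2D (q : ℂ) m n z (starRingEnd ℂ z) *
        starRingEnd ℂ (qHermite2D (q : ℂ) s t z (starRingEnd ℂ z)) /
          ((qPochhammerInf (-‖z‖ ^ 2) q : ℝ) : ℂ)) MeasureTheory.volume ∧
    ∫ z : ℂ, qHermite2D (q : ℂ) m n z (starRingEnd ℂ z) *
        starRingEnd ℂ (qHermite2D (q : ℂ) s t z (starRingEnd ℂ z)) /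
          ((qPochhammerInf (-‖z‖ ^ 2) q : ℝ) : ℂ) =
      if m = s ∧ n = t then
        ((Real.pi * Real.log q⁻¹ * qPochhammer q q m * qPochhammer q q n /
          q ^ (((m : ℝ) - (n : ℝ)) ^ 2 / 2 + ((m : ℝ) + (n : ℝ)) / 2) : ℝ) : ℂ)
      else 0 := by
  have hint : ∀ j ∈ range (min m n + 1), ∀ k ∈ range (min s t + 1),
      MeasureTheory.Integrable fun z : ℂ =>
        qHermite2DCoeff (q : ℂ) m n j * qHermite2DCoeff (q : ℂ) s t k *
          weightedMonomial q (m - j + (t - k)) (n - j + (s - k)) z := fun j _ k _ =>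
    (integrable_weightedMonomial hq0 hq1 _ _).const_mul _
  simp only [qHermite2D_mul_conj_div]
  refine ⟨MeasureTheory.integrable_finsetSum _ fun j hj =>
    MeasureTheory.integrable_finsetSum _ fun k hk => hint j hj k hk, ?_⟩
  have hpair : ∫ z : ℂ, ∑ j ∈ range (min m n + 1), ∑ k ∈ range (min s t + 1),
      qHermite2DCoeff (q : ℂ) m n j * qHermite2DCoeff (q : ℂ) s t k *
        weightedMonomial q (m - j + (t - k)) (n - j + (s - k)) z =
      ((Real.pi * Real.log q⁻¹ : ℝ) : ℂ) * qHermite2DPairing (q : ℂ) m n s t := by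
    rw [MeasureTheory.integral_finsetSum _ fun j hj =>
      MeasureTheory.integrable_finsetSum _ fun k hk => hint j hj k hk, qHermite2DPairing, mul_sum]
    refine sum_congr rfl fun j hj => ?_
    rw [MeasureTheory.integral_finsetSum _ fun k hk => hint j hj k hk, mul_sum]
    refine sum_congr rfl fun k _ => ?_
    rw [MeasureTheory.integral_const_mul, integral_weightedMonomial hq0 hq1]
    ring
  have hqc : (q : ℂ) ≠ 0 := by exact_mod_cast hq0.ne'
  rw [hpair, qHermite2DPairing_eq hqc (qPochhammer_self_ne_zero hq0 hq1)]
  split_ifs with h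
  · have hexp : q ^ (((m : ℝ) - n) ^ 2 / 2 + ((m : ℝ) + n) / 2) * q ^ (m * n) =
        q ^ ((m + 1).choose 2) * q ^ ((n + 1).choose 2) := by
      rw [← pow_add, ← Real.rpow_natCast q (m * n), ← Real.rpow_natCast q (_ + _),
        ← Real.rpow_add hq0]
      congr 1
      push_cast [Nat.cast_choose_two]
      ring
    have hcast : ∀ k, qPochhammer (q : ℂ) q k = ((qPochhammer q q k : ℝ) : ℂ) := fun k => by
      simp [qPochhammer]
    have hpos : 0 < q ^ (((m : ℝ) - n) ^ 2 / 2 + ((m : ℝ) + n) / 2) := Real.rpow_pos_of_pos hq0 _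
    generalize q ^ (((m : ℝ) - n) ^ 2 / 2 + ((m : ℝ) + n) / 2) = E at hexp hpos ⊢
    rw [hcast, hcast]
    norm_cast
    rw [← hexp]
    field_simp
  · rw [mul_zero]
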